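/- Let $k\ge 0$. Consider finite directed graphs without loops, up to isomorphism, whose vertices are labeled by unordered pairs $\{i,j\}$, $1\le i,j\le k$ ($i=j$ allowed), and whose directed edges are counted mod 2 (there may be edges in both directions between two vertices). Such a graph is \emph{semisymmetric} if, for every vertex $v$ labeled $\{i,i\}$ and every other vertex $w$, there is an edge from $v$ to $w$ if and only if there is an edge from $w$ to $v$. Let $\mathcal C$ be either the set of all semisymmetric graphs or the set of all graphs, and let $V_{\mathcal C}$ be the complex vector space with basis $\mathcal C$. For a graph $G$ with distinct vertices $A,B$ labeled $\{i,j\}$ and $\{i,l\}$ ($j,l$ may be equal to each other or to $i$), let $G'_{AB}$ be $G$ with one edge added in each direction between $A$ and $B$ (mod 2). Let $\widetilde G_{AB}$ be obtained from $G$ by changing the label of $A$ to $\{j,l\}$, adding (mod 2), for each vertex $C\ne A,B$, an edge from $A$ to $C$ (respectively from $C$ to $A$) if $G$ has an edge from $B$ to $C$ (respectively from $C$ to $B$), and, if $i\ne l$, also adding (mod 2) one edge in each direction between $A$ and $B$. Let $\widetilde G'_{AB}=(\widetilde G_{AB})'_{AB}$. Let $F_{\mathcal C}$ be the quotient of $V_{\mathcal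 C}$ by the span of all 4-term relations $$G-G'_{AB}-\widetilde G_{AB}+\widetilde G'_{AB}$$ whose four graphs belong to $\mathcal C$. Define the product $G_1\cdot G_2$ to be the disjoint union of $G_1$ and $G_2$, together with an edge (counted mod 2) from $v_1\in V(G_1)$ to $v_2\in V(G_2)$ for each pair consisting of an entry of the label of $v_1$ and an entry of the label of $v_2$ of the same color, and the coproduct by $$\mu(G)=\sum_{J\subseteq V(G)} G_J\otimes G_{V(G)\setminus J},$$ where $G_J$ is the subgraph induced by $J$. Then $\mathcal C$ is closed under products and induced subgraphs, and the product and coproduct induce on $F_{\mathcal C}$ the structure of a cocommutative bialgebra over $\mathbb C$, with the empty graph as unit and the counit sending the empty graph to $1$ and every other graph to $0$. If $k\ge 3$, this bialgebra is not commutative. -/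

import Mathlib

open scoped TensorProduct

/-- A directed multigraph without loops on the vertex set `V`, with every vertex labeled by an
unordered pair `{i, j}` (possibly `i = j`) of colors in a `k`-element set.  Directed edges are
counted mod 2: `edge v w` is the number mod 2 of directed edges from `v` to `w`. -/
@[ext]
structure DGraph (k : ℕ) (V : Type) where
  label : V → Sym2 (Fin k)
  edge : V → V → ZMod 2
  loopless : ∀ v, edge v v = 0

namespace DGraph

variable {k : ℕ} {V W : Type}

/-- For every vertex `v` labeled `{i, i}` and any other vertex `w`, there is a directed edge from
`v` to `w` if and only if there is a directed edge from `w` to `v`. -/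
def Semisymmetric (G : DGraph k V) : Prop :=
  ∀ (v : V) (i : Fin k), G.label v = s(i, i) → ∀ w : V, w ≠ v →
    (G.edge v w = 1 ↔ G.edge w v = 1)

/-- Isomorphism of labeled directed graphs. -/
def Isomorphic (G : DGraph k V) (H : DGraph k W) : Prop :=
  ∃ f : V ≃ W, (∀ v, H.label (f v) = G.label v) ∧ ∀ v w, H.edge (f v) (f w) = G.edge v w

/-- The graph pulled back along an injection of vertex sets. -/
def comap (G : DGraph k V) (f : W ↪ V) : DGraph k W where
  label w := G.label (f w)
  edge v w := G.edge (f v) (f w)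
  loopless _ := G.loopless _

/-- The subgraph `G_J` induced by a set `J` of vertices. -/
def induce (G : DGraph k V) (J : Finset V) : DGraph k J :=
  G.comap (Function.Embedding.subtype (· ∈ J))

/-- The graph with no vertices. -/
def empty (k : ℕ) : DGraph k Empty where
  label := Empty.elim
  edge v _ := v.elim
  loopless v := v.elim

/-- The multiplicity (0, 1 or 2) of a color in an unordered pair. -/
def colorCount (c : Fin k) (p : Sym2 (Fin k)) : ℕ :=
  Sym2.lift ⟨fun a b => (if a = c then 1 else 0) + (if b = c then 1 else 0),
    fun _ _ => Nat.add_comm _ _⟩ p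

/-- The number of coincidences between the entries of two labels: the number of pairs consisting
of an entry of `p` and an entry of `q` of the same color. -/
def overlap (p q : Sym2 (Fin k)) : ℕ :=
  ∑ c : Fin k, colorCount c p * colorCount c q

/-- The product `G · H`: the disjoint union, together with a directed edge from `v` in `G` to `w`
in `H` for each coincidence of colors between their labels (edges being counted mod 2). -/
def prod (G : DGraph k V) (H : DGraph k W) : DGraph k (V ⊕ W) where
  label := Sum.elim G.label H.label
  edge
    | .inl v, .inl v' => G.edge v v'
    | .inr w, .inr w' => H.edge w w'
    | .inl v, .inr w => (overlap (G.label v) (H.label w) : ZMod 2)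
    | .inr _, .inl _ => 0
  loopless v := by
    cases v with
    | inl v => exact G.loopless v
    | inr w => exact H.loopless w

variable [DecidableEq V]

/-- Complementing the edge `AB`: a directed edge is added in each direction between the distinct
vertices `A` and `B`, and edges are cancelled mod 2. -/
def complement (G : DGraph k V) {A B : V} (hAB : A ≠ B) : DGraph k V where
  label := G.label
  edge x y := G.edge x y + if (x = A ∧ y = B) ∨ (x = B ∧ y = A) then 1 else 0
  loopless v := by
    have h : ¬ ((v = A ∧ v = B) ∨ (v = B ∧ v = A)) := by
      rintro (⟨h1, h2⟩ | ⟨h1, h2⟩)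
      · exact hAB (h1.symm.trans h2)
      · exact hAB (h2.symm.trans h1)
    simp [h, G.loopless v]

/-- The label of `A` is replaced by `p`, and for every vertex `C ≠ A` a directed edge from `A` to
`C` (respectively from `C` to `A`) is added if there is one from `B` to `C` (respectively from `C`
to `B`), with cancellation mod 2.  (For `C = B` nothing is added, there being no loops.) -/
def slide (G : DGraph k V) (A B : V) (p : Sym2 (Fin k)) : DGraph k V where
  label := Function.update G.label A p
  edge x y := G.edge x y + (if x = A ∧ y ≠ A then G.edge B y else 0)
    + (if y = A ∧ x ≠ A then G.edge x B else 0)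
  loopless v := by
    have h : ¬ (v = A ∧ v ≠ A) := fun h => h.2 h.1
    simp [h, G.loopless v]

/-- The graph `G̃_{AB}`, where `A` has label `{i, j}` and `B` has label `{i, l}`: the label of `A`
becomes `{j, l}`, the edges at `B` are added to those at `A`, and the edge `AB` is complemented if
`i ≠ l`. -/
def tilde (G : DGraph k V) {A B : V} (hAB : A ≠ B) (i j l : Fin k) : DGraph k V :=
  if i ≠ l then (G.slide A B s(j, l)).complement hAB else G.slide A B s(j, l)

end DGraph

/-- Isomorphism of finite labeled directed graphs (on the vertex sets `Fin n`). -/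
instance DGraph.isoSetoid (k : ℕ) : Setoid (Σ n : ℕ, DGraph k (Fin n)) where
  r G H := G.2.Isomorphic H.2
  iseqv :=
    { refl := fun G => ⟨Equiv.refl _, fun _ => rfl, fun _ _ => rfl⟩
      symm := fun {G H} ⟨f, h1, h2⟩ => ⟨f.symm, fun v => by rw [← h1, f.apply_symm_apply],
        fun v w => by rw [← h2, f.apply_symm_apply, f.apply_symm_apply]⟩
      trans := fun {G H K} ⟨f, h1, h2⟩ ⟨g, h3, h4⟩ => ⟨f.trans g,
        fun v => by rw [Equiv.trans_apply, h3, h1],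
        fun v w => by rw [Equiv.trans_apply, Equiv.trans_apply, h4, h2]⟩ }

/-- Isomorphism classes of finite labeled directed graphs. -/
abbrev GraphClass (k : ℕ) : Type := Quotient (DGraph.isoSetoid k)

/-- The isomorphism class of a labeled directed graph on an arbitrary finite vertex set. -/
noncomputable def DGraph.cls {k : ℕ} {V : Type} [Fintype V] (G : DGraph k V) : GraphClass k :=
  ⟦⟨Fintype.card V, G.comap (Fintype.equivFin V).symm.toEmbedding⟩⟧

theorem DGraph.cls_eq_iff {k : ℕ} {V W : Type} [Fintype V] [Fintype W]
    (G : DGraph k V) (H : DGraph k W) : G.cls = H.cls ↔ G.Isomorphic H := by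
  unfold DGraph.cls
  rw [Quotient.eq]
  constructor
  · rintro ⟨f, h1, h2⟩
    refine ⟨(Fintype.equivFin V).trans (f.trans (Fintype.equivFin W).symm), fun v => ?_,
      fun v w => ?_⟩
    · simpa [DGraph.comap] using h1 (Fintype.equivFin V v)
    · simpa [DGraph.comap] using h2 (Fintype.equivFin V v) (Fintype.equivFin V w)
  · rintro ⟨f, h1, h2⟩
    refine ⟨(Fintype.equivFin V).symm.trans (f.trans (Fintype.equivFin W)), fun v => ?_,
      fun v w => ?_⟩
    · simpa [DGraph.comap] using h1 ((Fintype.equivFin V).symm v)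
    · simpa [DGraph.comap] using h2 ((Fintype.equivFin V).symm v) ((Fintype.equivFin V).symm w)

theorem DGraph.Isomorphic.semisymmetric {k : ℕ} {V W : Type} {G : DGraph k V} {H : DGraph k W}
    (h : G.Isomorphic H) (hG : G.Semisymmetric) : H.Semisymmetric := by
  obtain ⟨f, h1, h2⟩ := h
  intro v i hv w hw
  obtain ⟨v, rfl⟩ := f.surjective v
  obtain ⟨w, rfl⟩ := f.surjective w
  rw [h2, h2]
  exact hG v i (by rw [← h1, hv]) w (fun e => hw (by rw [e]))

/-- The isomorphism classes of the semisymmetric graphs. -/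
def semisymmetricClasses (k : ℕ) : Set (GraphClass k) :=
  {c | ∃ (n : ℕ) (G : DGraph k (Fin n)), G.Semisymmetric ∧ G.cls = c}

theorem DGraph.cls_mem_semisymmetricClasses {k : ℕ} {V : Type} [Fintype V] (G : DGraph k V) :
    G.cls ∈ semisymmetricClasses k ↔ G.Semisymmetric := by
  constructor
  · rintro ⟨n, H, hH, e⟩
    exact ((DGraph.cls_eq_iff _ _).1 e).semisymmetric hH
  · intro hG
    have hi : G.Isomorphic (G.comap (Fintype.equivFin V).symm.toEmbedding) :=
      ⟨Fintype.equivFin V, fun v => by simp [DGraph.comap], fun v w => by simp [DGraph.comap]⟩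
    exact ⟨_, _, hi.semisymmetric hG, ((DGraph.cls_eq_iff _ _).2 hi).symm⟩

/-- The complex vector space of formal linear combinations of (isomorphism classes of) graphs
belonging to a set `C` of isomorphism classes. -/
abbrev GraphSpace {k : ℕ} (C : Set (GraphClass k)) : Type := C →₀ ℂ

/-- A graph in `C` as a basis element of the space. -/
noncomputable def graphVec {k : ℕ} (C : Set (GraphClass k)) {V : Type} [Fintype V]
    (G : DGraph k V) (hG : G.cls ∈ C) : GraphSpace C :=
  Finsupp.single ⟨G.cls, hG⟩ 1

/-- The span of all the elements `G - G'_{AB} - G̃_{AB} + G̃'_{AB}` that lie in the space, where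
`A` and `B` are distinct vertices of `G` with labels `{i, j}` and `{i, l}`. -/
noncomputable def fourTermRelations {k : ℕ} (C : Set (GraphClass k)) : Submodule ℂ (GraphSpace C) :=
  Submodule.span ℂ
    {x | ∃ (n : ℕ) (G : DGraph k (Fin n)) (A B : Fin n) (hAB : A ≠ B) (i j l : Fin k),
      G.label A = s(i, j) ∧ G.label B = s(i, l) ∧
      ∃ (h : G.cls ∈ C) (h' : (G.complement hAB).cls ∈ C)
        (ht : (G.tilde hAB i j l).cls ∈ C)
        (ht' : ((G.tilde hAB i j l).complement hAB).cls ∈ C),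
        x = graphVec C G h - graphVec C (G.complement hAB) h'
          - graphVec C (G.tilde hAB i j l) ht
          + graphVec C ((G.tilde hAB i j l).complement hAB) ht'}

/-- The space of graphs in `C` modulo the 4-term relation. -/
abbrev FourTermQuotient {k : ℕ} (C : Set (GraphClass k)) : Type :=
  GraphSpace C ⧸ fourTermRelations C

/-- The class of a graph in the quotient by the 4-term relation. -/
noncomputable def graphMk {k : ℕ} (C : Set (GraphClass k)) {V : Type} [Fintype V]
    (G : DGraph k V) (hG : G.cls ∈ C) : FourTermQuotient C :=
  (fourTermRelations C).mkQ (graphVec C G hG)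

namespace DGraph

variable {k : ℕ} {V W U V' W' : Type}

/-! ### Isomorphisms of graphs -/

/-! Everything happens at the level of graphs, before linear combinations. When the label `{i,j}` of
`A` becomes `{j,l}`, its number of coincidences with any label `q` changes mod 2 by that of `{i,l}`,
because the color `i` is counted twice (`overlap_slide`). So the cross edges at `A` in a product
change exactly as sliding over `B` prescribes: the four graphs of a relation, multiplied by a fixed
graph on either side, are the four graphs of another relation. The product therefore descends.
Associativity and the unit laws are isomorphisms of graphs. Semisymmetry survives products because
`{i,i}` has an even number of coincidences with every label.

For the coproduct, fix a subset `J`. If `A` and `B` lie on the same side of `J`, that side carries a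
4-term relation and the other side is the same in all four graphs. If `J` separates them,
complementing `AB` is invisible and the terms cancel in pairs. Coassociativity, cocommutativity and
multiplicativity are reindexings of sums over subsets.

Noncommutativity is detected by an integer invariant. Orient cyclically the labels `{0,1}`, `{1,2}`,
`{2,0}`, and count edges along this orientation minus edges against it. The change under
complementing `AB` is the sign of the two labels times an expression in the two edge residues. When
`i ≠ l` the slide negates both factors; when `i = l` it changes neither. Hence the 4-term relation
holds (`triangleCount_tilde`). The invariant takes the values `1` and `-1` on the two products of
the single vertices `{0,1}` and `{1,2}`. -/

theorem Isomorphic.refl (G : DGraph k V) : G.Isomorphic G :=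
  ⟨Equiv.refl _, fun _ => rfl, fun _ _ => rfl⟩

theorem Isomorphic.symm {G : DGraph k V} {H : DGraph k W} (h : G.Isomorphic H) :
    H.Isomorphic G := by
  obtain ⟨f, h1, h2⟩ := h
  exact ⟨f.symm, fun v => by rw [← h1, f.apply_symm_apply],
    fun v w => by rw [← h2, f.apply_symm_apply, f.apply_symm_apply]⟩

theorem Isomorphic.trans {G : DGraph k V} {H : DGraph k W} {K : DGraph k U}
    (h : G.Isomorphic H) (h' : H.Isomorphic K) : G.Isomorphic K := by
  obtain ⟨f, h1, h2⟩ := h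
  obtain ⟨g, h3, h4⟩ := h'
  exact ⟨f.trans g, fun v => by rw [Equiv.trans_apply, h3, h1],
    fun v w => by rw [Equiv.trans_apply, Equiv.trans_apply, h4, h2]⟩

theorem Isomorphic.prod {G : DGraph k V} {H : DGraph k W} {G' : DGraph k V'} {H' : DGraph k W'}
    (h : G.Isomorphic G') (h' : H.Isomorphic H') : (G.prod H).Isomorphic (G'.prod H') := by
  obtain ⟨f, h1, h2⟩ := h
  obtain ⟨g, h3, h4⟩ := h'
  refine ⟨Equiv.sumCongr f g, ?_, ?_⟩
  · rintro (v | w)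
    · exact h1 v
    · exact h3 w
  · rintro (v | w) (v' | w')
    · exact h2 v v'
    · simp [DGraph.prod, h1, h3]
    · rfl
    · exact h4 w w'

theorem comap_isomorphic (G : DGraph k V) (e : W ≃ V) : (G.comap e.toEmbedding).Isomorphic G :=
  ⟨e, fun _ => rfl, fun _ _ => rfl⟩

theorem isomorphic_comap_equivFin [Fintype V] (G : DGraph k V) :
    G.Isomorphic (G.comap (Fintype.equivFin V).symm.toEmbedding) :=
  (comap_isomorphic G _).symm

theorem isomorphic_out [Fintype V] (G : DGraph k V) : G.Isomorphic (Quotient.out G.cls).2 := by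
  have h := Quotient.mk_out (s := DGraph.isoSetoid k)
    ⟨Fintype.card V, G.comap (Fintype.equivFin V).symm.toEmbedding⟩
  exact (isomorphic_comap_equivFin G).trans (Isomorphic.symm h)

theorem induce_isomorphic_of_map_eq {G : DGraph k V} {H : DGraph k W} (f : V ≃ W)
    (h1 : ∀ v, H.label (f v) = G.label v) (h2 : ∀ v w, H.edge (f v) (f w) = G.edge v w)
    {J : Finset V} {K : Finset W} (h : J.map f.toEmbedding = K) :
    (G.induce J).Isomorphic (H.induce K) := by
  subst h
  exact ⟨f.subtypeEquiv (fun v => by simp), fun v => h1 v, fun v w => h2 v w⟩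

theorem induce_univ_isomorphic [Fintype V] (G : DGraph k V) :
    (G.induce Finset.univ).Isomorphic G :=
  ⟨Equiv.subtypeUnivEquiv Finset.mem_univ, fun _ => rfl, fun _ _ => rfl⟩

theorem induce_induce_isomorphic (G : DGraph k V) (J : Finset V) (K : Finset J) :
    ((G.induce J).induce K).Isomorphic (G.induce (K.map (Function.Embedding.subtype (· ∈ J)))) := by
  refine ⟨⟨fun x => ⟨x.1.1, Finset.mem_map.2 ⟨x.1, x.2, rfl⟩⟩, fun y => ⟨⟨y.1, ?_⟩, ?_⟩,
    fun x => rfl, fun y => rfl⟩, fun _ => rfl, fun _ _ => rfl⟩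
  · obtain ⟨z, -, hz⟩ := Finset.mem_map.1 y.2
    rw [← hz]; exact z.2
  · obtain ⟨z, hz, hz'⟩ := Finset.mem_map.1 y.2
    rwa [show z = ⟨y.1, _⟩ from Subtype.ext hz'] at hz

theorem isomorphic_of_isEmpty [IsEmpty V] [IsEmpty W] (G : DGraph k V) (H : DGraph k W) :
    G.Isomorphic H :=
  ⟨Equiv.equivOfIsEmpty V W, fun v => isEmptyElim v, fun v => isEmptyElim v⟩

/-! ### The product of graphs -/

theorem empty_prod_isomorphic (G : DGraph k V) : ((empty k).prod G).Isomorphic G :=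
  ⟨Equiv.emptySum Empty V, by rintro (⟨⟨⟩⟩ | v); rfl, by rintro (⟨⟨⟩⟩ | v) (⟨⟨⟩⟩ | w); rfl⟩

theorem prod_empty_isomorphic (G : DGraph k V) : (G.prod (empty k)).Isomorphic G :=
  ⟨Equiv.sumEmpty V Empty, by rintro (v | ⟨⟨⟩⟩); rfl, by rintro (v | ⟨⟨⟩⟩) (w | ⟨⟨⟩⟩); rfl⟩

/-- Cross edges depend only on labels and always run from left to right, so both bracketings give
the same edges. -/
theorem prod_assoc_isomorphic (G : DGraph k V) (H : DGraph k W) (K : DGraph k U) :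
    ((G.prod H).prod K).Isomorphic (G.prod (H.prod K)) :=
  ⟨Equiv.sumAssoc V W U, by rintro ((v | w) | u) <;> rfl,
    by rintro ((v | w) | u) ((v' | w') | u') <;> rfl⟩

@[simp]
theorem prod_label_inl (G : DGraph k V) (H : DGraph k W) (v : V) :
    (G.prod H).label (.inl v) = G.label v := rfl

@[simp]
theorem prod_label_inr (G : DGraph k V) (H : DGraph k W) (w : W) :
    (G.prod H).label (.inr w) = H.label w := rfl

@[simp]
theorem prod_edge_inl_inl (G : DGraph k V) (H : DGraph k W) (v v' : V) :
    (G.prod H).edge (.inl v) (.inl v') = G.edge v v' := rfl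

@[simp]
theorem prod_edge_inr_inr (G : DGraph k V) (H : DGraph k W) (w w' : W) :
    (G.prod H).edge (.inr w) (.inr w') = H.edge w w' := rfl

@[simp]
theorem prod_edge_inl_inr (G : DGraph k V) (H : DGraph k W) (v : V) (w : W) :
    (G.prod H).edge (.inl v) (.inr w) = overlap (G.label v) (H.label w) := rfl

@[simp]
theorem prod_edge_inr_inl (G : DGraph k V) (H : DGraph k W) (v : V) (w : W) :
    (G.prod H).edge (.inr w) (.inl v) = 0 := rfl

theorem induce_disjSum_isomorphic (G : DGraph k V) (H : DGraph k W) (J : Finset V) (K : Finset W) :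
    ((G.prod H).induce (J.disjSum K)).Isomorphic ((G.induce J).prod (H.induce K)) := by
  refine Isomorphic.symm ⟨⟨Sum.elim (fun v => ⟨.inl v.1, by simp⟩) (fun w => ⟨.inr w.1, by simp⟩),
    fun x => match x with
      | ⟨.inl v, h⟩ => .inl ⟨v, by simpa using h⟩
      | ⟨.inr w, h⟩ => .inr ⟨w, by simpa using h⟩, ?_, ?_⟩, ?_, ?_⟩
  · rintro (v | w) <;> rfl
  · rintro ⟨v | w, h⟩ <;> rfl
  · rintro (v | w) <;> rfl
  · rintro (v | w) (v' | w') <;> rfl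

/-! ### Coincidences between labels mod 2 -/

theorem overlap_mk (i j : Fin k) (q : Sym2 (Fin k)) :
    overlap s(i, j) q = colorCount i q + colorCount j q := by
  simp [overlap, colorCount, add_mul, Finset.sum_add_distrib]

theorem overlap_comm (p q : Sym2 (Fin k)) : overlap p q = overlap q p := by
  simp [overlap, mul_comm]

theorem overlap_diag (i : Fin k) (q : Sym2 (Fin k)) : (overlap s(i, i) q : ZMod 2) = 0 := by
  rw [overlap_mk, Nat.cast_add, CharTwo.add_self_eq_zero]

/-- On the right the color `i` occurs twice and cancels mod 2. This identity makes the product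
compatible with sliding. -/
theorem overlap_slide (i j l : Fin k) (q : Sym2 (Fin k)) :
    (overlap s(j, l) q : ZMod 2) = overlap s(i, j) q + overlap s(i, l) q := by
  simp only [overlap_mk, Nat.cast_add]
  linear_combination -CharTwo.add_self_eq_zero (colorCount i q : ZMod 2)

/-! ### Semisymmetric graphs -/

theorem Semisymmetric.comap {G : DGraph k V} (hG : G.Semisymmetric) (f : W ↪ V) :
    (G.comap f).Semisymmetric :=
  fun v i hv w hw => hG (f v) i hv (f w) (fun h => hw (f.injective h))

theorem Semisymmetric.prod {G : DGraph k V} {H : DGraph k W} (hG : G.Semisymmetric)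
    (hH : H.Semisymmetric) : (G.prod H).Semisymmetric := by
  rintro (v | v) i hv (w | w) hw
  · exact hG v i hv w (fun h => hw (by rw [h]))
  · have hv' : G.label v = s(i, i) := hv
    have : (overlap (G.label v) (H.label w) : ZMod 2) = 0 := by rw [hv', overlap_diag]
    simp [DGraph.prod, this]
  · have hv' : H.label v = s(i, i) := hv
    have : (overlap (G.label w) (H.label v) : ZMod 2) = 0 := by
      rw [overlap_comm, hv', overlap_diag]
    simp [DGraph.prod, this]
  · exact hH v i hv w (fun h => hw (by rw [h]))

/-! ### Complementing and sliding -/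

section

variable [DecidableEq V] [DecidableEq W]

theorem comap_complement (G : DGraph k V) (f : W ↪ V) {A B : W} (hAB : A ≠ B)
    (hAB' : f A ≠ f B) : (G.complement hAB').comap f = (G.comap f).complement hAB := by
  ext <;> simp [complement, comap]

theorem comap_slide (G : DGraph k V) (f : W ↪ V) (A B : W) (p : Sym2 (Fin k)) :
    (G.slide (f A) (f B) p).comap f = (G.comap f).slide A B p := by
  ext x y
  · by_cases h : x = A <;> simp [slide, comap, h]
  · simp [slide, comap]

theorem comap_tilde (G : DGraph k V) (f : W ↪ V) {A B : W} (hAB : A ≠ B)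
    (hAB' : f A ≠ f B) (i j l : Fin k) :
    (G.tilde hAB' i j l).comap f = (G.comap f).tilde hAB i j l := by
  unfold tilde
  split_ifs
  · rw [comap_complement _ f hAB, comap_slide]
  · rw [comap_slide]

theorem comap_complement_of_forall_ne (G : DGraph k V) {A B : V} (hAB : A ≠ B) (f : U ↪ V)
    (h : (∀ u, f u ≠ A) ∨ (∀ u, f u ≠ B)) : (G.complement hAB).comap f = G.comap f := by
  ext x y
  · rfl
  · rcases h with h | h <;> simp [complement, comap, h]

theorem comap_slide_of_forall_ne (G : DGraph k V) (A B : V) (p : Sym2 (Fin k)) (f : U ↪ V)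
    (h : ∀ u, f u ≠ A) : (G.slide A B p).comap f = G.comap f := by
  ext x y
  · simp [slide, comap, h]
  · simp [slide, comap, h]

/-- Avoiding `A` suffices: sliding alters only the label and the edges of `A`, and the possible
complementation concerns only `AB`. -/
theorem comap_tilde_of_forall_ne (G : DGraph k V) {A B : V} (hAB : A ≠ B) (i j l : Fin k)
    (f : U ↪ V) (h : ∀ u, f u ≠ A) : (G.tilde hAB i j l).comap f = G.comap f := by
  unfold tilde
  split_ifs
  · rw [comap_complement_of_forall_ne _ hAB f (.inl h), comap_slide_of_forall_ne _ _ _ _ f h]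
  · rw [comap_slide_of_forall_ne _ _ _ _ f h]

theorem complement_prod (G : DGraph k V) (H : DGraph k W) {A B : V} (hAB : A ≠ B)
    (hAB' : (Sum.inl A : V ⊕ W) ≠ Sum.inl B) :
    (G.complement hAB).prod H = (G.prod H).complement hAB' := by
  ext x y
  · rfl
  · rcases x with v | w <;> rcases y with v' | w' <;> simp [complement]

theorem prod_complement (G : DGraph k V) (H : DGraph k W) {A B : W} (hAB : A ≠ B)
    (hAB' : (Sum.inr A : V ⊕ W) ≠ Sum.inr B) :
    G.prod (H.complement hAB) = (G.prod H).complement hAB' := by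
  ext x y
  · rfl
  · rcases x with v | w <;> rcases y with v' | w' <;> simp [complement]

/-- The only nontrivial case is a cross edge at `A`, where the change of label must match the cross
edges added from `B`; this is `overlap_slide`. -/
theorem slide_prod (G : DGraph k V) (H : DGraph k W) {A B : V} {i j l : Fin k}
    (hA : G.label A = s(i, j)) (hB : G.label B = s(i, l)) :
    (G.slide A B s(j, l)).prod H = (G.prod H).slide (.inl A) (.inl B) s(j, l) := by
  ext x y
  · rcases x with v | w
    · by_cases h : v = A <;> simp [slide, h]
    · simp [slide]
  · rcases x with v | w <;> rcases y with v' | w'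
    · simp [slide]
    · by_cases h : v = A
      · simpa [slide, h, hA, hB] using overlap_slide i j l (H.label w')
      · simp [slide, h]
    · simp [slide]
    · simp [slide]

theorem prod_slide (G : DGraph k V) (H : DGraph k W) {A B : W} {i j l : Fin k}
    (hA : H.label A = s(i, j)) (hB : H.label B = s(i, l)) :
    G.prod (H.slide A B s(j, l)) = (G.prod H).slide (.inr A) (.inr B) s(j, l) := by
  ext x y
  · rcases x with v | w
    · simp [slide]
    · by_cases h : w = A <;> simp [slide, h]
  · rcases x with v | w <;> rcases y with v' | w'
    · simp [slide]
    · by_cases h : w' = A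
      · simpa [slide, h, hA, hB, overlap_comm (G.label v)] using overlap_slide i j l (G.label v)
      · simp [slide, h]
    · simp [slide]
    · simp [slide]

theorem tilde_prod (G : DGraph k V) (H : DGraph k W) {A B : V} (hAB : A ≠ B)
    (hAB' : (Sum.inl A : V ⊕ W) ≠ Sum.inl B) {i j l : Fin k}
    (hA : G.label A = s(i, j)) (hB : G.label B = s(i, l)) :
    (G.tilde hAB i j l).prod H = (G.prod H).tilde hAB' i j l := by
  unfold tilde
  split_ifs
  · rw [complement_prod _ _ hAB hAB', slide_prod _ _ hA hB]
  · rw [slide_prod _ _ hA hB]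

theorem prod_tilde (G : DGraph k V) (H : DGraph k W) {A B : W} (hAB : A ≠ B)
    (hAB' : (Sum.inr A : V ⊕ W) ≠ Sum.inr B) {i j l : Fin k}
    (hA : H.label A = s(i, j)) (hB : H.label B = s(i, l)) :
    G.prod (H.tilde hAB i j l) = (G.prod H).tilde hAB' i j l := by
  unfold tilde
  split_ifs
  · rw [prod_complement _ _ hAB hAB', prod_slide _ _ hA hB]
  · rw [prod_slide _ _ hA hB]

end

end DGraph

/-! ### Functions on graphs satisfying the 4-term relation -/

open DGraph

/-- A set of isomorphism classes of graphs containing the empty graph and closed under products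
and induced subgraphs. -/
class ClosedFamily {k : ℕ} (C : Set (GraphClass k)) : Prop where
  empty_mem : (DGraph.empty k).cls ∈ C
  prod_mem {V W : Type} [Fintype V] [Fintype W] {G : DGraph k V} {H : DGraph k W} :
    G.cls ∈ C → H.cls ∈ C → (G.prod H).cls ∈ C
  comap_mem {V W : Type} [Fintype V] [Fintype W] {G : DGraph k V} (f : W ↪ V) :
    G.cls ∈ C → (G.comap f).cls ∈ C

instance {k : ℕ} : ClosedFamily (Set.univ : Set (GraphClass k)) :=
  ⟨trivial, fun _ _ => trivial, fun _ _ => trivial⟩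

instance {k : ℕ} : ClosedFamily (semisymmetricClasses k) where
  empty_mem := (cls_mem_semisymmetricClasses _).2 fun v => v.elim
  prod_mem hG hH := (cls_mem_semisymmetricClasses _).2
    (((cls_mem_semisymmetricClasses _).1 hG).prod ((cls_mem_semisymmetricClasses _).1 hH))
  comap_mem f hG := (cls_mem_semisymmetricClasses _).2
    (((cls_mem_semisymmetricClasses _).1 hG).comap f)

/-- An isomorphism invariant of graphs satisfying the 4-term relation for graphs in `C`. -/
structure FourTermFunction {k : ℕ} (C : Set (GraphClass k)) (E : Type*) [AddCommGroup E] where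
  toFun : ∀ (V : Type) [Fintype V] [DecidableEq V], DGraph k V → E
  iso : ∀ {V W : Type} [Fintype V] [DecidableEq V] [Fintype W] [DecidableEq W]
    {G : DGraph k V} {H : DGraph k W}, G.Isomorphic H → toFun V G = toFun W H
  four_term : ∀ {V : Type} [Fintype V] [DecidableEq V] (G : DGraph k V) (A B : V) (hAB : A ≠ B)
    (i j l : Fin k), G.label A = s(i, j) → G.label B = s(i, l) → G.cls ∈ C →
    (G.complement hAB).cls ∈ C → (G.tilde hAB i j l).cls ∈ C →
    ((G.tilde hAB i j l).complement hAB).cls ∈ C →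
    toFun V G - toFun V (G.complement hAB) - toFun V (G.tilde hAB i j l)
      + toFun V ((G.tilde hAB i j l).complement hAB) = 0

section

variable {k : ℕ} {C : Set (GraphClass k)} {E : Type*} [AddCommGroup E] [Module ℂ E]

/-- The linear extension of an invariant to formal linear combinations of graphs. -/
noncomputable def FourTermFunction.extend (φ : FourTermFunction C E) : GraphSpace C →ₗ[ℂ] E :=
  Finsupp.lift E ℂ C fun c => φ.toFun _ (Quotient.out c.1).2

theorem FourTermFunction.extend_graphVec (φ : FourTermFunction C E) {V : Type} [Fintype V]
    [DecidableEq V] (G : DGraph k V) (hG : G.cls ∈ C) :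
    φ.extend (graphVec C G hG) = φ.toFun V G := by
  simp only [extend, graphVec, Finsupp.lift_apply, zero_smul, Finsupp.sum_single_index, one_smul]
  exact φ.iso (isomorphic_out G).symm

/-- The linear map on the quotient by the 4-term relation induced by an invariant. -/
noncomputable def FourTermFunction.lift (φ : FourTermFunction C E) :
    FourTermQuotient C →ₗ[ℂ] E :=
  (fourTermRelations C).liftQ φ.extend <| Submodule.span_le.2 <| by
    rintro x ⟨n, G, A, B, hAB, i, j, l, hA, hB, h, h', ht, ht', rfl⟩
    have := φ.four_term G A B hAB i j l hA hB h h' ht ht'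
    simpa [φ.extend_graphVec] using this

theorem FourTermFunction.lift_graphMk (φ : FourTermFunction C E) {V : Type} [Fintype V]
    [DecidableEq V] (G : DGraph k V) (hG : G.cls ∈ C) :
    φ.lift (graphMk C G hG) = φ.toFun V G :=
  φ.extend_graphVec G hG

theorem graphMk_eq_of_isomorphic {V W : Type} [Fintype V] [Fintype W] {G : DGraph k V}
    {H : DGraph k W} (hG : G.cls ∈ C) (hH : H.cls ∈ C) (h : G.Isomorphic H) :
    graphMk C G hG = graphMk C H hH := by
  have : (⟨G.cls, hG⟩ : C) = ⟨H.cls, hH⟩ := Subtype.ext ((cls_eq_iff G H).2 h)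
  simp only [graphMk, graphVec, this]

open Classical in
/-- The class of a graph in the quotient by the 4-term relation, or `0` if the graph does not belong
to `C`. -/
noncomputable def graphMk' (C : Set (GraphClass k)) {V : Type} [Fintype V] (G : DGraph k V) :
    FourTermQuotient C :=
  if h : G.cls ∈ C then graphMk C G h else 0

/-- Passing to `graphMk'` removes the membership proof, so that graphs can be replaced by isomorphic
ones by rewriting. -/
theorem graphMk_eq {V : Type} [Fintype V] (G : DGraph k V) (hG : G.cls ∈ C) :
    graphMk C G hG = graphMk' C G := (dif_pos hG).symm

theorem graphMk'_eq_zero {V : Type} [Fintype V] {G : DGraph k V} (hG : G.cls ∉ C) :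
    graphMk' C G = 0 := dif_neg hG

theorem DGraph.Isomorphic.graphMk'_eq {V W : Type} [Fintype V] [Fintype W] {G : DGraph k V}
    {H : DGraph k W} (h : G.Isomorphic H) : graphMk' C G = graphMk' C H := by
  by_cases hG : G.cls ∈ C
  · have hH : H.cls ∈ C := (cls_eq_iff G H).2 h ▸ hG
    rw [← graphMk_eq G hG, ← graphMk_eq H hH, graphMk_eq_of_isomorphic hG hH h]
  · have hH : H.cls ∉ C := (cls_eq_iff G H).2 h ▸ hG
    rw [graphMk'_eq_zero hG, graphMk'_eq_zero hH]

theorem FourTermQuotient.induction_on {p : FourTermQuotient C → Prop} (x : FourTermQuotient C)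
    (graph : ∀ (n : ℕ) (G : DGraph k (Fin n)), G.cls ∈ C → p (graphMk' C G)) (zero : p 0)
    (add : ∀ x y, p x → p y → p (x + y)) (smul : ∀ (r : ℂ) x, p x → p (r • x)) : p x := by
  obtain ⟨x, rfl⟩ := Submodule.mkQ_surjective _ x
  induction x using Finsupp.induction_linear with
  | zero => rwa [map_zero]
  | add x y hx hy => rw [map_add]; exact add _ _ hx hy
  | single c r =>
    obtain ⟨c, hc⟩ := c
    induction c using Quotient.inductionOn with
    | h G =>
      have e : (⟦G⟧ : GraphClass k) = G.2.cls :=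
        Quotient.sound (s := DGraph.isoSetoid k) (isomorphic_comap_equivFin G.2)
      have h := smul r _ (graph G.1 G.2 (e ▸ hc))
      rw [← graphMk_eq G.2 (e ▸ hc), graphMk, graphVec, ← map_smul, Finsupp.smul_single,
        smul_eq_mul, mul_one] at h
      simpa only [← e] using h

theorem FourTermQuotient.hom_ext {f g : FourTermQuotient C →ₗ[ℂ] E}
    (h : ∀ (n : ℕ) (G : DGraph k (Fin n)), G.cls ∈ C → f (graphMk' C G) = g (graphMk' C G)) :
    f = g := by
  refine LinearMap.ext fun x => ?_
  induction x using induction_on with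
  | graph n G hG => exact h n G hG
  | zero => simp
  | add x y hx hy => simp [hx, hy]
  | smul r x hx => simp [hx]

/-- The defining relations live on `Fin n`; all constructions commute with pulling back along a
bijection of vertex sets, which gives the relation on any finite vertex set. -/
theorem graphMk'_four_term {V : Type} [Fintype V] [DecidableEq V] (G : DGraph k V) (A B : V)
    (hAB : A ≠ B) (i j l : Fin k) (hA : G.label A = s(i, j)) (hB : G.label B = s(i, l))
    (h : G.cls ∈ C) (h' : (G.complement hAB).cls ∈ C) (ht : (G.tilde hAB i j l).cls ∈ C)
    (ht' : ((G.tilde hAB i j l).complement hAB).cls ∈ C) :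
    graphMk' C G - graphMk' C (G.complement hAB) - graphMk' C (G.tilde hAB i j l)
      + graphMk' C ((G.tilde hAB i j l).complement hAB) = 0 := by
  let e := (Fintype.equivFin V).symm
  obtain ⟨A, rfl⟩ := e.surjective A
  obtain ⟨B, rfl⟩ := e.surjective B
  have hAB₀ : A ≠ B := fun h => hAB (by rw [h])
  have key : ∀ K : DGraph k V, graphMk' C K = graphMk' C (K.comap e.toEmbedding) :=
    fun K => (comap_isomorphic K e).symm.graphMk'_eq
  have mem : ∀ K : DGraph k V, K.cls ∈ C → (K.comap e.toEmbedding).cls ∈ C :=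
    fun K hK => (cls_eq_iff _ _).2 (comap_isomorphic K e) ▸ hK
  have c1 : (G.complement hAB).comap e.toEmbedding = (G.comap e.toEmbedding).complement hAB₀ :=
    comap_complement G e.toEmbedding hAB₀ hAB
  have c2 : (G.tilde hAB i j l).comap e.toEmbedding = (G.comap e.toEmbedding).tilde hAB₀ i j l :=
    comap_tilde G e.toEmbedding hAB₀ hAB i j l
  have c3 : ((G.tilde hAB i j l).complement hAB).comap e.toEmbedding
      = ((G.comap e.toEmbedding).tilde hAB₀ i j l).complement hAB₀ := by
    rw [← c2]; exact comap_complement _ e.toEmbedding hAB₀ hAB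
  replace h := mem _ h
  replace h' := mem _ h'
  replace ht := mem _ ht
  replace ht' := mem _ ht'
  rw [key, key (G.complement hAB), key (G.tilde hAB i j l), key ((G.tilde hAB i j l).complement hAB)]
  rw [c1] at h' ⊢
  rw [c2] at ht ⊢
  rw [c3] at ht' ⊢
  rw [← graphMk_eq _ h, ← graphMk_eq _ h', ← graphMk_eq _ ht, ← graphMk_eq _ ht']
  simp only [graphMk, ← map_sub, ← map_add]
  exact (Submodule.Quotient.mk_eq_zero _).2 (Submodule.subset_span
    ⟨_, G.comap e.toEmbedding, A, B, hAB₀, i, j, l, hA, hB, h, h', ht, ht', rfl⟩)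

end

/-! ### The bialgebra structure -/

namespace FourTermQuotient

variable {k : ℕ} {C : Set (GraphClass k)} [ClosedFamily C]

/-! ### The product on the quotient -/

/-- Conversely, both factors are induced subgraphs of the product. Hence multiplicativity of
`graphMk'` holds even for graphs outside `C`, both sides being zero. -/
theorem prod_mem_iff {V W : Type} [Fintype V] [Fintype W] {G : DGraph k V} {H : DGraph k W} :
    (G.prod H).cls ∈ C ↔ G.cls ∈ C ∧ H.cls ∈ C :=
  ⟨fun h => ⟨ClosedFamily.comap_mem (G := G.prod H) Function.Embedding.inl h,
    ClosedFamily.comap_mem (G := G.prod H) Function.Embedding.inr h⟩,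
    fun h => ClosedFamily.prod_mem h.1 h.2⟩

theorem induce_mem {V : Type} [Fintype V] {G : DGraph k V} (hG : G.cls ∈ C) (J : Finset V) :
    (G.induce J).cls ∈ C :=
  ClosedFamily.comap_mem _ hG

/-- Left multiplication by a graph. -/
noncomputable def leftMulFunction (C : Set (GraphClass k)) [ClosedFamily C] {V : Type} [Fintype V]
    (G : DGraph k V) : FourTermFunction C (FourTermQuotient C) where
  toFun _ _ _ H := graphMk' C (G.prod H)
  iso h := ((Isomorphic.refl G).prod h).graphMk'_eq
  four_term {W _ _} H A B hAB i j l hA hB h h' ht ht' := by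
    classical
    have hAB' : (Sum.inr A : V ⊕ W) ≠ Sum.inr B := fun h => hAB (Sum.inr_injective h)
    by_cases hG : G.cls ∈ C
    · have := graphMk'_four_term (C := C) (G.prod H) _ _ hAB' i j l hA hB
      rw [← prod_complement G H hAB hAB', ← prod_tilde G H hAB hAB' hA hB,
        ← prod_complement G _ hAB hAB'] at this
      simp only [prod_mem_iff] at this
      exact this ⟨hG, h⟩ ⟨hG, h'⟩ ⟨hG, ht⟩ ⟨hG, ht'⟩
    · have : ∀ K : DGraph k W, graphMk' C (G.prod K) = 0 :=
        fun K => graphMk'_eq_zero fun h => hG (prod_mem_iff.1 h).1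
      simp [this]

theorem leftMulFunction_lift {V W : Type} [Fintype V] [Fintype W] (G : DGraph k V)
    (H : DGraph k W) : (leftMulFunction C G).lift (graphMk' C H) = graphMk' C (G.prod H) := by
  classical
  by_cases hH : H.cls ∈ C
  · rw [← graphMk_eq H hH, FourTermFunction.lift_graphMk, leftMulFunction]
  · rw [graphMk'_eq_zero hH, map_zero, graphMk'_eq_zero fun h => hH (prod_mem_iff.1 h).2]

/-- Left multiplication as an invariant of graphs. -/
noncomputable def mulFunction (C : Set (GraphClass k)) [ClosedFamily C] :
    FourTermFunction C (FourTermQuotient C →ₗ[ℂ] FourTermQuotient C) where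
  toFun _ _ _ G := (leftMulFunction C G).lift
  iso h := hom_ext fun n H hH => by
    simp only [leftMulFunction_lift]
    exact (h.prod (Isomorphic.refl H)).graphMk'_eq
  four_term {V _ _} G A B hAB i j l hA hB h h' ht ht' := hom_ext fun n H hH => by
    have hAB' : (Sum.inl A : V ⊕ Fin n) ≠ Sum.inl B := fun h => hAB (Sum.inl_injective h)
    simp only [leftMulFunction_lift, LinearMap.add_apply, LinearMap.sub_apply,
      LinearMap.zero_apply]
    have := graphMk'_four_term (C := C) (G.prod H) _ _ hAB' i j l hA hB
    rw [← complement_prod G H hAB hAB', ← tilde_prod G H hAB hAB' hA hB,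
      ← complement_prod _ H hAB hAB'] at this
    simp only [prod_mem_iff] at this
    exact this ⟨h, hH⟩ ⟨h', hH⟩ ⟨ht, hH⟩ ⟨ht', hH⟩

/-- The product on the quotient by the 4-term relation, as a bilinear map. -/
noncomputable def mulHom (C : Set (GraphClass k)) [ClosedFamily C] :
    FourTermQuotient C →ₗ[ℂ] FourTermQuotient C →ₗ[ℂ] FourTermQuotient C :=
  (mulFunction C).lift

theorem mulHom_graphMk' {V W : Type} [Fintype V] [Fintype W] (G : DGraph k V) (H : DGraph k W) :
    mulHom C (graphMk' C G) (graphMk' C H) = graphMk' C (G.prod H) := by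
  classical
  by_cases hG : G.cls ∈ C
  · rw [← graphMk_eq G hG, mulHom, FourTermFunction.lift_graphMk]
    exact leftMulFunction_lift G H
  · rw [graphMk'_eq_zero hG, map_zero, LinearMap.zero_apply,
      graphMk'_eq_zero fun h => hG (prod_mem_iff.1 h).1]

theorem mulHom_one_left (x : FourTermQuotient C) :
    mulHom C (graphMk' C (DGraph.empty k)) x = x := by
  suffices mulHom C (graphMk' C (DGraph.empty k)) = LinearMap.id from congr($this x)
  refine hom_ext fun n G hG => ?_
  rw [mulHom_graphMk', LinearMap.id_apply, (empty_prod_isomorphic G).graphMk'_eq]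

theorem mulHom_one_right (x : FourTermQuotient C) :
    mulHom C x (graphMk' C (DGraph.empty k)) = x := by
  suffices (mulHom C).flip (graphMk' C (DGraph.empty k)) = LinearMap.id from congr($this x)
  refine hom_ext fun n G hG => ?_
  rw [LinearMap.flip_apply, mulHom_graphMk', LinearMap.id_apply,
    (prod_empty_isomorphic G).graphMk'_eq]

theorem mulHom_assoc (x y z : FourTermQuotient C) :
    mulHom C (mulHom C x y) z = mulHom C x (mulHom C y z) := by
  induction x using induction_on with
  | zero => simp
  | add x x' hx hx' => simp [hx, hx']
  | smul r x hx => simp [hx]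
  | graph _ G _ =>
    induction y using induction_on with
    | zero => simp
    | add y y' hy hy' => simp [hy, hy']
    | smul r y hy => simp [hy]
    | graph _ H _ =>
      induction z using induction_on with
      | zero => simp
      | add z z' hz hz' => simp [hz, hz']
      | smul r z hz => simp [hz]
      | graph _ K _ =>
        simp only [mulHom_graphMk']
        exact (prod_assoc_isomorphic G H K).graphMk'_eq

noncomputable instance instRing : Ring (FourTermQuotient C) where
  -- Reusing the quotient's additive group keeps the ring compatible with the existing complex
  -- vector space structure.
  __ := Submodule.Quotient.addCommGroup (fourTermRelations C)
  mul x y := mulHom C x y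
  one := graphMk' C (DGraph.empty k)
  left_distrib x y z := map_add (mulHom C x) y z
  right_distrib x y z := congr($(map_add (mulHom C) x y) z)
  zero_mul x := congr($(map_zero (mulHom C)) x)
  mul_zero x := map_zero (mulHom C x)
  mul_assoc := mulHom_assoc
  one_mul := mulHom_one_left
  mul_one := mulHom_one_right

noncomputable instance instAlgebra : Algebra ℂ (FourTermQuotient C) :=
  Algebra.ofModule (fun r x y => congr($(map_smul (mulHom C) r x) y))
    (fun r x y => map_smul (mulHom C x) r y)

theorem graphMk'_mul {V W : Type} [Fintype V] [Fintype W] (G : DGraph k V) (H : DGraph k W) :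
    graphMk' C G * graphMk' C H = graphMk' C (G.prod H) :=
  mulHom_graphMk' G H

theorem one_eq : (1 : FourTermQuotient C) = graphMk' C (DGraph.empty k) := rfl

end FourTermQuotient

/-! ### The coproduct, the counit and the bialgebra axioms -/

namespace FourTermQuotient

variable {k : ℕ} {C : Set (GraphClass k)} [ClosedFamily C]

/-- The coproduct as an invariant of graphs. -/
noncomputable def comulFunction (C : Set (GraphClass k)) [ClosedFamily C] :
    FourTermFunction C (FourTermQuotient C ⊗[ℂ] FourTermQuotient C) where
  toFun V _ _ G := ∑ J : Finset V, graphMk' C (G.induce J) ⊗ₜ graphMk' C (G.induce Jᶜ)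
  iso := by
    rintro V W _ _ _ _ G H ⟨f, h1, h2⟩
    refine Fintype.sum_equiv f.finsetCongr _ _ fun J => ?_
    rw [(induce_isomorphic_of_map_eq f h1 h2 (J := J) rfl).graphMk'_eq,
      (induce_isomorphic_of_map_eq f h1 h2 (J := Jᶜ) (K := (f.finsetCongr J)ᶜ) ?_).graphMk'_eq]
    · rfl
    · ext x
      simp
  four_term {V _ _} G A B hAB i j l hA hB h h' ht ht' := by
    rw [← Finset.sum_sub_distrib, ← Finset.sum_sub_distrib, ← Finset.sum_add_distrib]
    refine Finset.sum_eq_zero fun J _ => ?_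
    have inside : ∀ J : Finset V, A ∈ J → B ∈ J →
        graphMk' C (G.induce J) - graphMk' C ((G.complement hAB).induce J)
          - graphMk' C ((G.tilde hAB i j l).induce J)
          + graphMk' C (((G.tilde hAB i j l).complement hAB).induce J) = 0 := by
      intro J hAJ hBJ
      have hAB' : (⟨A, hAJ⟩ : J) ≠ ⟨B, hBJ⟩ := fun h => hAB congr($(h).1)
      have := graphMk'_four_term (C := C) (G.induce J) _ _ hAB' i j l hA hB
      simp only [induce] at this ⊢
      have c := fun K : DGraph k V =>
        comap_complement K (Function.Embedding.subtype (· ∈ J)) hAB' hAB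
      have t := comap_tilde G (Function.Embedding.subtype (· ∈ J)) hAB' hAB i j l
      rw [← c, ← t, ← c] at this
      exact this (induce_mem h J) (induce_mem h' J) (induce_mem ht J) (induce_mem ht' J)
    have outside : ∀ J : Finset V, A ∉ J ∨ B ∉ J → ∀ K : DGraph k V,
        (K.complement hAB).induce J = K.induce J := fun J hJ K =>
      comap_complement_of_forall_ne K hAB _ (hJ.imp (fun h u hu => h (hu ▸ u.2))
        (fun h u hu => h (hu ▸ u.2)))
    have outside_tilde : ∀ J : Finset V, A ∉ J → (G.tilde hAB i j l).induce J = G.induce J :=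
      fun J hJ => comap_tilde_of_forall_ne G hAB i j l _ (fun u hu => hJ (hu ▸ u.2))
    by_cases hAJ : A ∈ J <;> by_cases hBJ : B ∈ J
    -- Both vertices lie in `J`: the right tensor factor is constant, and the left factors form a
    -- 4-term relation.
    · have hAJ' : A ∉ Jᶜ := by simpa using hAJ
      rw [outside Jᶜ (.inl hAJ'), outside Jᶜ (.inl hAJ'), outside_tilde Jᶜ hAJ',
        ← TensorProduct.sub_tmul, ← TensorProduct.sub_tmul, ← TensorProduct.add_tmul,
        inside J hAJ hBJ, TensorProduct.zero_tmul]
    -- `J` separates `A` from `B`: the edge `AB` is seen on neither side, so each graph cancels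
    -- against its complemented version.
    · have hAJ' : A ∉ Jᶜ := by simpa using hAJ
      rw [outside Jᶜ (.inl hAJ'), outside Jᶜ (.inl hAJ'), outside J (.inr hBJ),
        outside J (.inr hBJ)]
      abel
    · have hBJ' : B ∉ Jᶜ := by simpa using hBJ
      rw [outside Jᶜ (.inr hBJ'), outside Jᶜ (.inr hBJ'), outside J (.inl hAJ),
        outside J (.inl hAJ)]
      abel
    · rw [outside J (.inl hAJ), outside J (.inl hAJ), outside_tilde J hAJ,
        ← TensorProduct.tmul_sub, ← TensorProduct.tmul_sub, ← TensorProduct.tmul_add,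
        inside Jᶜ (by simpa using hAJ) (by simpa using hBJ), TensorProduct.tmul_zero]

/-- The counit as an invariant of graphs. -/
noncomputable def counitFunction (C : Set (GraphClass k)) : FourTermFunction C ℂ where
  toFun V _ _ _ := if Fintype.card V = 0 then 1 else 0
  iso := by
    rintro V W _ _ _ _ G H ⟨f, -, -⟩
    rw [Fintype.card_congr f]
  four_term G A _ _ _ _ _ _ _ _ _ _ _ := by
    simp [Fintype.card_eq_zero_iff, show ¬ IsEmpty _ from fun h => h.elim A]

noncomputable instance instCoalgebraStruct : CoalgebraStruct ℂ (FourTermQuotient C) where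
  comul := (comulFunction C).lift
  counit := (counitFunction C).lift

theorem comul_graphMk' {V : Type} [Fintype V] [DecidableEq V] {G : DGraph k V} (hG : G.cls ∈ C) :
    Coalgebra.comul (R := ℂ) (graphMk' C G) =
      ∑ J : Finset V, graphMk' C (G.induce J) ⊗ₜ[ℂ] graphMk' C (G.induce Jᶜ) := by
  rw [← graphMk_eq G hG]
  exact (comulFunction C).lift_graphMk G hG

theorem counit_graphMk' {V : Type} [Fintype V] {G : DGraph k V} (hG : G.cls ∈ C) :
    Coalgebra.counit (R := ℂ) (graphMk' C G) = if Fintype.card V = 0 then 1 else 0 := by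
  classical
  rw [← graphMk_eq G hG]
  exact (counitFunction C).lift_graphMk G hG

theorem counit_graphMk'_induce {V : Type} [Fintype V] [DecidableEq V] {G : DGraph k V} (hG : G.cls ∈ C)
    (J : Finset V) :
    Coalgebra.counit (R := ℂ) (graphMk' C (G.induce J)) = if J = ∅ then 1 else 0 := by
  rw [counit_graphMk' (induce_mem hG J), Fintype.card_coe]
  simp only [Finset.card_eq_zero]

theorem sum_finset_coe {V M : Type*} [DecidableEq V] [AddCommMonoid M] (J : Finset V)
    (F : Finset V → M) :
    ∑ K : Finset J, F (K.map (Function.Embedding.subtype (· ∈ J))) = ∑ K ∈ J.powerset, F K := by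
  refine Finset.sum_nbij' (fun K => K.map (Function.Embedding.subtype (· ∈ J)))
    (fun K => K.subtype (· ∈ J)) ?_ ?_ ?_ ?_ ?_
  · intro K _
    simp only [Finset.mem_powerset]
    intro x hx
    obtain ⟨y, -, rfl⟩ := Finset.mem_map.1 hx
    exact y.2
  · simp
  · intro K _
    ext x
    simp
  · intro K hK
    rw [Finset.subtype_map, Finset.filter_true_of_mem fun x hx => Finset.mem_powerset.1 hK hx]
  · simp

theorem map_subtype_compl {V : Type*} [DecidableEq V] (J : Finset V) (K : Finset J) :
    Kᶜ.map (Function.Embedding.subtype (· ∈ J)) =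
      J \ K.map (Function.Embedding.subtype (· ∈ J)) := by
  ext x
  by_cases hx : x ∈ J <;> simp [hx]

/-- Summing over subsets of the ambient vertex set turns the iterated coproduct into a sum over
flags `K ⊆ J`. -/
theorem comul_graphMk'_induce {V : Type} [Fintype V] [DecidableEq V] {G : DGraph k V}
    (hG : G.cls ∈ C) (J : Finset V) :
    Coalgebra.comul (R := ℂ) (graphMk' C (G.induce J)) =
      ∑ K ∈ J.powerset, graphMk' C (G.induce K) ⊗ₜ[ℂ] graphMk' C (G.induce (J \ K)) := by
  rw [comul_graphMk' (induce_mem hG J), ← sum_finset_coe]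
  refine Finset.sum_congr rfl fun K _ => ?_
  rw [(induce_induce_isomorphic G J K).graphMk'_eq, (induce_induce_isomorphic G J Kᶜ).graphMk'_eq,
    map_subtype_compl]

noncomputable instance instCoalgebra : Coalgebra ℂ (FourTermQuotient C) where
  coassoc := by
    refine hom_ext fun n G hG => ?_
    simp only [LinearMap.comp_apply, LinearEquiv.coe_coe, comul_graphMk' hG, map_sum,
      LinearMap.rTensor_tmul, LinearMap.lTensor_tmul, comul_graphMk'_induce hG,
      TensorProduct.sum_tmul, TensorProduct.tmul_sum, TensorProduct.assoc_tmul]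
    rw [Finset.sum_sigma', Finset.sum_sigma']
    -- Both sides sum over ordered partitions of the vertices into three parts: `K ⊆ J` corresponds
    -- to `K`, `J \ K`, `Jᶜ`.
    refine Finset.sum_nbij' (fun x => ⟨x.2, x.1 \ x.2⟩) (fun x => ⟨x.1 ∪ x.2, x.1⟩) ?_ ?_ ?_ ?_ ?_
    · rintro ⟨J, K⟩ h
      simp only [Finset.mem_sigma, Finset.mem_univ, Finset.mem_powerset, true_and] at h ⊢
      exact fun x hx => Finset.mem_compl.2 (Finset.mem_sdiff.1 hx).2
    · rintro ⟨J, K⟩ h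
      simp only [Finset.mem_sigma, Finset.mem_univ, Finset.mem_powerset, true_and]
      exact Finset.subset_union_left
    · rintro ⟨J, K⟩ h
      simp only [Finset.mem_sigma, Finset.mem_univ, Finset.mem_powerset, true_and] at h
      simp [Finset.union_sdiff_of_subset h]
    · rintro ⟨J, K⟩ h
      simp only [Finset.mem_sigma, Finset.mem_univ, Finset.mem_powerset, true_and] at h
      have : Disjoint J K := (Finset.subset_compl_iff_disjoint_left).1 h
      simp [Finset.union_sdiff_cancel_left this]
    · rintro ⟨J, K⟩ h
      simp only [Finset.mem_sigma, Finset.mem_univ, Finset.mem_powerset, true_and] at h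
      have : Kᶜ \ (J \ K) = Jᶜ := by
        ext x
        have := @h x
        simp only [Finset.mem_sdiff, Finset.mem_compl]
        tauto
      dsimp only
      rw [this]
  rTensor_counit_comp_comul := by
    refine hom_ext fun n G hG => ?_
    simp only [LinearMap.comp_apply, comul_graphMk' hG, map_sum, LinearMap.rTensor_tmul,
      counit_graphMk'_induce hG, TensorProduct.mk_apply]
    rw [Finset.sum_eq_single ∅ (fun J _ hJ => by simp [hJ]) (by simp), Finset.compl_empty,
      (induce_univ_isomorphic G).graphMk'_eq, if_pos rfl]
  lTensor_counit_comp_comul := by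
    refine hom_ext fun n G hG => ?_
    simp only [LinearMap.comp_apply, comul_graphMk' hG, map_sum, LinearMap.lTensor_tmul,
      counit_graphMk'_induce hG, TensorProduct.mk_apply, LinearMap.flip_apply]
    rw [Finset.sum_eq_single Finset.univ (fun J _ hJ => by simp [hJ]) (by simp),
      Finset.compl_univ, (induce_univ_isomorphic G).graphMk'_eq, if_pos rfl]

theorem counit_mul (x y : FourTermQuotient C) :
    Coalgebra.counit (R := ℂ) (x * y) =
      Coalgebra.counit (R := ℂ) x * Coalgebra.counit (R := ℂ) y := by
  induction x using induction_on with
  | zero => simp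
  | add x x' hx hx' => simp [add_mul, hx, hx']
  | smul r x hx => rw [smul_mul_assoc, map_smul, hx, map_smul, smul_mul_assoc]
  | graph _ G hG =>
    induction y using induction_on with
    | zero => simp
    | add y y' hy hy' => simp [mul_add, hy, hy']
    | smul r y hy => rw [mul_smul_comm, map_smul, hy, map_smul, mul_smul_comm]
    | graph _ H hH =>
      rw [graphMk'_mul, counit_graphMk' (prod_mem_iff.2 ⟨hG, hH⟩), counit_graphMk' hG,
        counit_graphMk' hH, Fintype.card_sum]
      split_ifs <;> simp_all

theorem comul_mul (x y : FourTermQuotient C) :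
    Coalgebra.comul (R := ℂ) (x * y) =
      Coalgebra.comul (R := ℂ) x * Coalgebra.comul (R := ℂ) y := by
  induction x using induction_on with
  | zero => simp
  | add x x' hx hx' => simp [add_mul, hx, hx']
  | smul r x hx => rw [smul_mul_assoc, map_smul, hx, map_smul, smul_mul_assoc]
  | graph _ G hG =>
    induction y using induction_on with
    | zero => simp
    | add y y' hy hy' => simp [mul_add, hy, hy']
    | smul r y hy => rw [mul_smul_comm, map_smul, hy, map_smul, mul_smul_comm]
    | graph _ H hH =>
      rw [graphMk'_mul, comul_graphMk' (prod_mem_iff.2 ⟨hG, hH⟩), comul_graphMk' hG,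
        comul_graphMk' hH, Finset.sum_mul_sum, ← Fintype.sum_prod_type']
      -- A subset of the product's vertices is a pair of subsets of the factors' vertices, and the
      -- induced graph is the product of the induced graphs.
      refine (Fintype.sum_equiv Finset.sumEquiv.toEquiv.symm _ _ fun x => ?_).symm
      obtain ⟨J, K⟩ := x
      have e : (J.disjSum K)ᶜ = Jᶜ.disjSum Kᶜ := by
        ext (v | w) <;> simp
      change _ = graphMk' C ((G.prod H).induce (J.disjSum K)) ⊗ₜ[ℂ]
        graphMk' C ((G.prod H).induce (J.disjSum K)ᶜ)
      rw [e, (induce_disjSum_isomorphic G H J K).graphMk'_eq,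
        (induce_disjSum_isomorphic G H Jᶜ Kᶜ).graphMk'_eq, Algebra.TensorProduct.tmul_mul_tmul,
        graphMk'_mul, graphMk'_mul]

theorem counit_one : Coalgebra.counit (R := ℂ) (1 : FourTermQuotient C) = 1 := by
  rw [one_eq, counit_graphMk' ClosedFamily.empty_mem]
  simp

theorem comul_one : Coalgebra.comul (R := ℂ) (1 : FourTermQuotient C) = 1 := by
  rw [one_eq, comul_graphMk' ClosedFamily.empty_mem, Fintype.sum_unique]
  rw [((isomorphic_of_isEmpty ((DGraph.empty k).induce default) (DGraph.empty k))).graphMk'_eq,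
    ((isomorphic_of_isEmpty ((DGraph.empty k).induce defaultᶜ) (DGraph.empty k))).graphMk'_eq]
  rfl

noncomputable instance instBialgebra : Bialgebra ℂ (FourTermQuotient C) :=
  Bialgebra.mk' ℂ _ counit_one (counit_mul _ _) comul_one (comul_mul _ _)

instance instIsCocomm : Coalgebra.IsCocomm ℂ (FourTermQuotient C) where
  comm_comp_comul := by
    refine hom_ext fun n G hG => ?_
    simp only [LinearMap.comp_apply, LinearEquiv.coe_coe, comul_graphMk' hG, map_sum,
      TensorProduct.comm_tmul]
    refine Fintype.sum_equiv (Function.Involutive.toPerm compl compl_involutive) _ _ fun J => ?_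
    rw [Function.Involutive.coe_toPerm, compl_compl]

/-! ### Noncommutativity -/

/-- The color of an element of `Fin k` among `0`, `1`, `2` and others. -/
def truncateColor (i : Fin k) : Fin 4 := ⟨min i 3, by omega⟩

/-- The edges of the triangle on `0`, `1`, `2`, cyclically ordered. -/
def triangleEdge (c : Fin 3) : Sym2 (Fin 4) := s(c.castSucc, (c + 1).castSucc)

/-- The cyclic orientation of pairs of edges of the triangle on `0`, `1`, `2`, and zero on all other
pairs of labels. -/
def triangleSign (p q : Sym2 (Fin 4)) : ℤ :=
  ∑ c : Fin 3, ((if p = triangleEdge c ∧ q = triangleEdge (c + 1) then 1 else 0) -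
    (if q = triangleEdge c ∧ p = triangleEdge (c + 1) then 1 else 0))

theorem triangleSign_comm (p q : Sym2 (Fin 4)) : triangleSign q p = -triangleSign p q := by
  simp [triangleSign]

/-- For a triangle on `i`, `j`, `l`, the edges `{i,j}` and `{j,l}` are the two cyclic neighbors of
`{i,l}`, on opposite sides; in the other cases both signs vanish. -/
theorem triangleSign_slide : ∀ i j l : Fin 4, i ≠ l →
    triangleSign s(j, l) s(i, l) = -triangleSign s(i, j) s(i, l) := by
  decide

theorem triangleSign_other : ∀ (p : Sym2 (Fin 4)) (j : Fin 4), triangleSign p s(3, j) = 0 := by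
  decide

/-- The color of an entry of a label among `0`, `1`, `2` and others. -/
def truncateLabel : Sym2 (Fin k) → Sym2 (Fin 4) := Sym2.map truncateColor

theorem triangleSign_truncate {i j l : Fin k} :
    triangleSign (truncateLabel s(j, l)) (truncateLabel s(i, l)) =
      (if i ≠ l then -1 else 1) * triangleSign (truncateLabel s(i, j)) (truncateLabel s(i, l)) := by
  simp only [truncateLabel, Sym2.map_mk]
  by_cases h : truncateColor i = truncateColor l
  · by_cases hil : i = l
    · subst hil
      rw [if_neg (by simp), one_mul, Sym2.eq_swap (a := truncateColor j)]
    -- Distinct colors with the same truncation are both at least `3`, and no triangle edge contains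
    -- the truncated color `3`.
    · have : truncateColor i = 3 := by
        simp only [truncateColor, Fin.ext_iff] at h hil ⊢
        change min _ _ = 3
        omega
      rw [this, triangleSign_other, triangleSign_other, mul_zero]
  · rw [if_pos fun e => h (by rw [e]), neg_one_mul, triangleSign_slide _ _ _ h]

/-- The number of edges along the orientation `triangleSign`, minus the number of edges against
it. -/
def triangleCount {V : Type} [Fintype V] (G : DGraph k V) : ℤ :=
  ∑ v, ∑ w, triangleSign (truncateLabel (G.label v)) (truncateLabel (G.label w)) *
    (G.edge v w).val

/-- The nontrivial sign of a residue mod 2. -/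
def modTwoSign (x : ZMod 2) : ℤ := if x = 0 then 1 else -1

theorem val_sub_val_add_one : ∀ x : ZMod 2, ((x.val : ℤ) - (x + 1).val) = -modTwoSign x := by
  decide

theorem modTwoSign_add_one : ∀ x : ZMod 2, modTwoSign (x + 1) = -modTwoSign x := by
  decide

/-- Only the ordered pairs `(A,B)` and `(B,A)` change; their contributions combine by antisymmetry
of `triangleSign`. -/
theorem triangleCount_sub_complement {V : Type} [Fintype V] [DecidableEq V] (G : DGraph k V)
    {A B : V} (hAB : A ≠ B) :
    triangleCount G - triangleCount (G.complement hAB) =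
      triangleSign (truncateLabel (G.label A)) (truncateLabel (G.label B)) *
        (modTwoSign (G.edge B A) - modTwoSign (G.edge A B)) := by
  have h : ∀ v w, triangleSign (truncateLabel (G.label v)) (truncateLabel (G.label w)) *
        (G.edge v w).val -
      triangleSign (truncateLabel (G.label v)) (truncateLabel (G.label w)) *
        ((G.complement hAB).edge v w).val =
      (if v = A then if w = B then
        triangleSign (truncateLabel (G.label A)) (truncateLabel (G.label B)) *
          -modTwoSign (G.edge A B) else 0 else 0) +
      (if v = B then if w = A then
        triangleSign (truncateLabel (G.label B)) (truncateLabel (G.label A)) *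
          -modTwoSign (G.edge B A) else 0 else 0) := by
    intro v w
    rw [← mul_sub]
    by_cases h1 : v = A ∧ w = B
    · obtain ⟨rfl, rfl⟩ := h1
      simp [-ZMod.natCast_val, complement, hAB, val_sub_val_add_one]
    · by_cases h2 : v = B ∧ w = A
      · obtain ⟨rfl, rfl⟩ := h2
        simp [-ZMod.natCast_val, complement, hAB.symm, val_sub_val_add_one]
      · rw [← ite_and, ← ite_and, if_neg h1, if_neg h2]
        simp [complement, h1, h2]
  have hl : (G.complement hAB).label = G.label := rfl
  simp only [triangleCount, ← Finset.sum_sub_distrib, hl, h, Finset.sum_add_distrib]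
  simp only [Finset.sum_ite_irrel, Finset.sum_ite_eq', Finset.mem_univ, if_true,
    Finset.sum_const_zero]
  rw [triangleSign_comm (truncateLabel (G.label A))]
  ring

theorem triangleCount_tilde {V : Type} [Fintype V] [DecidableEq V] (G : DGraph k V) {A B : V}
    (hAB : A ≠ B) {i j l : Fin k} (hA : G.label A = s(i, j)) (hB : G.label B = s(i, l)) :
    triangleCount G - triangleCount (G.complement hAB) - triangleCount (G.tilde hAB i j l)
      + triangleCount ((G.tilde hAB i j l).complement hAB) = 0 := by
  have h1 : (G.tilde hAB i j l).label A = s(j, l) := by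
    unfold tilde; split_ifs <;> simp [complement, slide]
  have h2 : (G.tilde hAB i j l).label B = s(i, l) := by
    unfold tilde; split_ifs <;> simp [complement, slide, hAB.symm, hB]
  -- Sliding leaves the edges between `A` and `B` alone, as it would only add a loop at `B`; only
  -- the complementation for `i ≠ l` counts.
  have h3 : (G.tilde hAB i j l).edge A B = G.edge A B + if i ≠ l then 1 else 0 := by
    unfold tilde; split_ifs <;> simp [complement, slide, hAB.symm, G.loopless]
  have h4 : (G.tilde hAB i j l).edge B A = G.edge B A + if i ≠ l then 1 else 0 := by
    unfold tilde; split_ifs <;> simp [complement, slide, hAB.symm, G.loopless]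
  have e1 := triangleCount_sub_complement G hAB
  have e2 := triangleCount_sub_complement (G.tilde hAB i j l) hAB
  rw [h1, h2, h3, h4, triangleSign_truncate] at e2
  rw [hA, hB] at e1
  by_cases hil : i = l
  · simp only [hil, ne_eq, not_true_eq_false, if_false, add_zero, one_mul] at e1 e2 ⊢
    linarith
  · simp only [hil, ne_eq, not_false_eq_true, if_true, modTwoSign_add_one] at e1 e2 ⊢
    linarith

/-- The invariant `triangleCount` with complex values. -/
def triangleFunction (C : Set (GraphClass k)) : FourTermFunction C ℂ where
  toFun _ _ _ G := (triangleCount G : ℂ)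
  iso := by
    rintro V W _ _ _ _ G H ⟨f, h1, h2⟩
    congr 1
    refine Fintype.sum_equiv f _ _ fun v => Fintype.sum_equiv f _ _ fun w => ?_
    rw [h1, h1, h2]
  four_term G _ _ hAB _ _ _ hA hB _ _ _ _ := by
    exact_mod_cast triangleCount_tilde G hAB hA hB

/-- The graph with a single vertex with label `p`. -/
def vertex (p : Sym2 (Fin k)) : DGraph k Unit where
  label _ := p
  edge _ _ := 0
  loopless _ := rfl

theorem vertex_semisymmetric (p : Sym2 (Fin k)) : (vertex p).Semisymmetric :=
  fun _ _ _ _ h => (h rfl).elim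

theorem exists_mul_ne_mul (hk : 3 ≤ k)
    (hC : ∀ G : DGraph k Unit, G.Semisymmetric → G.cls ∈ C) :
    ∃ x y : FourTermQuotient C, x * y ≠ y * x := by
  let G : DGraph k Unit := vertex s(⟨0, by omega⟩, ⟨1, by omega⟩)
  let H : DGraph k Unit := vertex s(⟨1, by omega⟩, ⟨2, by omega⟩)
  have hG : G.cls ∈ C := hC _ (vertex_semisymmetric _)
  have hH : H.cls ∈ C := hC _ (vertex_semisymmetric _)
  refine ⟨graphMk' C G, graphMk' C H, fun h => ?_⟩
  rw [graphMk'_mul, graphMk'_mul, ← graphMk_eq _ (prod_mem_iff.2 ⟨hG, hH⟩),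
    ← graphMk_eq _ (prod_mem_iff.2 ⟨hH, hG⟩)] at h
  have h := congr((triangleFunction C).lift $h)
  rw [FourTermFunction.lift_graphMk, FourTermFunction.lift_graphMk] at h
  have h : triangleCount (G.prod H) = triangleCount (H.prod G) := Int.cast_injective h
  have hGH : overlap (G.label ()) (H.label ()) = 1 := by
    simp [G, H, vertex, overlap_mk, colorCount]
  have tG : truncateLabel (G.label ()) = s(0, 1) := rfl
  have tH : truncateLabel (H.label ()) = s(1, 2) := rfl
  have eG : G.edge () () = 0 := rfl
  have eH : H.edge () () = 0 := rfl
  have s1 : triangleSign s(0, 1) s(1, 2) = 1 := by decide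
  have s2 : triangleSign s(1, 2) s(0, 1) = -1 := by decide
  simp [-ZMod.natCast_val, triangleCount, hGH, overlap_comm (H.label ()), tG, tH, eG, eH, s1, s2,
    ZMod.val_one] at h

end FourTermQuotient

/-! ### Assembly for both families of graphs -/

theorem theoremT (k : ℕ) (C : Set (GraphClass k))
    (hC : C = semisymmetricClasses k ∨ C = Set.univ) :
    ∃ (B : Type) (_ : Ring B) (_ : Bialgebra ℂ B) (e : FourTermQuotient C ≃ₗ[ℂ] B),
      -- the product is the one induced by the product of graphs
      (∀ (V W : Type) [Fintype V] [Fintype W] (G : DGraph k V) (H : DGraph k W)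
        (hG : G.cls ∈ C) (hH : H.cls ∈ C),
        ∃ hGH : (G.prod H).cls ∈ C,
          e (graphMk C G hG) * e (graphMk C H hH) = e (graphMk C (G.prod H) hGH)) ∧
      -- the unit is the empty graph
      (∃ h0 : (DGraph.empty k).cls ∈ C, e (graphMk C (DGraph.empty k) h0) = 1) ∧
      -- the coproduct is the one induced by the coproduct of graphs
      (∀ (V : Type) [Fintype V] [DecidableEq V] (G : DGraph k V) (hG : G.cls ∈ C),
        ∃ hJ : ∀ J : Finset V, (G.induce J).cls ∈ C,
          Coalgebra.comul (R := ℂ) (e (graphMk C G hG)) =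
            ∑ J : Finset V,
              e (graphMk C (G.induce J) (hJ J)) ⊗ₜ[ℂ] e (graphMk C (G.induce Jᶜ) (hJ Jᶜ))) ∧
      -- the counit is 1 on the empty graph and 0 on every other graph
      (∀ (V : Type) [Fintype V] (G : DGraph k V) (hG : G.cls ∈ C),
        Coalgebra.counit (R := ℂ) (e (graphMk C G hG)) = if Fintype.card V = 0 then 1 else 0) ∧
      Coalgebra.IsCocomm ℂ B ∧
      (3 ≤ k → ∃ x y : B, x * y ≠ y * x) := by 
  have : ClosedFamily C := by
    rcases hC with rfl | rfl <;> infer_instance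
  refine ⟨FourTermQuotient C, inferInstance, inferInstance, LinearEquiv.refl ℂ _, ?_,
    ⟨ClosedFamily.empty_mem, ?_⟩, ?_, ?_, inferInstance, fun hk => ?_⟩
  · intro V W _ _ G H hG hH
    refine ⟨ClosedFamily.prod_mem hG hH, ?_⟩
    simp only [graphMk_eq]
    exact FourTermQuotient.graphMk'_mul G H
  · simp only [graphMk_eq]
    rfl
  · intro V _ _ G hG
    refine ⟨FourTermQuotient.induce_mem hG, ?_⟩
    simp only [graphMk_eq]
    exact FourTermQuotient.comul_graphMk' hG
  · intro V _ G hG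
    simp only [graphMk_eq]
    exact FourTermQuotient.counit_graphMk' hG
  · refine FourTermQuotient.exists_mul_ne_mul hk fun G hG => ?_
    rcases hC with rfl | rfl
    · exact (DGraph.cls_mem_semisymmetricClasses G).2 hG
    · trivial
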